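/- Let $X$ be a super-reflexive real or complex Banach space, i.e. every Banach space finitely representable in $X$ is reflexive. Let $r_1, r_2, \dots$ be the Rademacher functions on $[0,1]$. For $0<\varepsilon\le 1$ let $\mathfrak{Q}_X(\varepsilon)$ be the least integer $N\ge 1$ such that for every $n\ge N$ and all $x_1,\dots,x_n\in X$ with $$\int_0^1\Big\|\sum_{k=1}^n r_k(t)\,x_k\Big\|\,dt\le 1$$ one has $\frac1n\sum_{k=1}^n\|x_k\|\le\varepsilon$. Then $\mathfrak{Q}_X(\varepsilon)$ exists (is finite) for every $0<\varepsilon\le 1$. Moreover, if $$\mathfrak{p}_X=\inf_{0<t<1}\frac{\log \mathfrak{Q}_X(t)}{\log(1/t)},$$ then every real $p>\mathfrak{p}_X$ is a classical Rademacher cotype of $X$: there is a constant $C>0$ such that for all $n$ and all $x_1,\dots,x_n\in X$, $$\sum_{k=1}^n\|x_k\|^p\le C\Big(\int_0^1\Big\|\sum_{k=1}^n r_k(t)\,x_k\Big\|\,dt\Big)^p .$$ -/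

import Mathlib

open MeasureTheory Set

universe u v

noncomputable section

/-- A Banach space is reflexive if the canonical embedding into its bidual is onto. -/
def IsReflexiveSpace (𝕜 : Type v) [RCLike 𝕜] (Y : Type u) [NormedAddCommGroup Y]
    [NormedSpace 𝕜 Y] : Prop :=
  Function.Surjective (NormedSpace.inclusionInDoubleDual 𝕜 Y)

/-- `Y` is finitely representable in `X`: every finite-dimensional subspace of `Y` is, for every
`ε > 0`, `(1 + ε)`-isomorphic to a subspace of `X`. (After scaling, an isomorphism `T` onto its
image with `‖T‖ ‖T⁻¹‖ ≤ 1 + ε` satisfies the two-sided bound below.) -/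
def FinitelyRepresentable (𝕜 : Type v) [RCLike 𝕜] (Y X : Type u)
    [NormedAddCommGroup Y] [NormedSpace 𝕜 Y] [NormedAddCommGroup X] [NormedSpace 𝕜 X] : Prop :=
  ∀ F : Submodule 𝕜 Y, FiniteDimensional 𝕜 F → ∀ ε : ℝ, 0 < ε →
    ∃ T : F →ₗ[𝕜] X, ∀ y : F, ‖y‖ ≤ ‖T y‖ ∧ ‖T y‖ ≤ (1 + ε) * ‖y‖

/-- `X` is super-reflexive: every Banach space finitely representable in `X` is reflexive.
(Letting `Y` range over the universe of `X` loses nothing: a non-reflexive space has a separable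
non-reflexive subspace, which has a copy in every universe.) -/
def SuperReflexive (𝕜 : Type v) [RCLike 𝕜] (X : Type u) [NormedAddCommGroup X]
    [NormedSpace 𝕜 X] : Prop :=
  ∀ (Y : Type u) [NormedAddCommGroup Y] [NormedSpace 𝕜 Y] [CompleteSpace Y],
    FinitelyRepresentable 𝕜 Y X → IsReflexiveSpace 𝕜 Y

/-- The `k`-th Rademacher function on `[0,1]` (`k = 1, 2, …`), with values `1` and `-1` alternating
on consecutive dyadic intervals of length `2⁻ᵏ`; it is `sign (sin (2ᵏ π t))` off the dyadic points
of order `k`. -/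
def rademacher (k : ℕ) (t : ℝ) : ℤ := (-1) ^ ⌊(2 : ℝ) ^ k * t⌋₊

/-- The Rademacher average `∫₀¹ ‖r₁(t) x₁ + ⋯ + rₙ(t) xₙ‖ dt`, with indices shifted by one. -/
def rademacherAverage {X : Type u} [NormedAddCommGroup X] {n : ℕ} (x : Fin n → X) : ℝ :=
  ∫ t in (0 : ℝ)..1, ‖∑ k : Fin n, rademacher (k + 1) t • x k‖

/-- The positive integers `N` such that, for all `n ≥ N`, any `n` vectors with Rademacher average
at most `1` satisfy `n⁻¹ ∑ ‖xₖ‖ ≤ ε`. -/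
def averageThresholds (X : Type u) [NormedAddCommGroup X] (ε : ℝ) : Set ℕ :=
  {N | 1 ≤ N ∧ ∀ n : ℕ, N ≤ n → ∀ x : Fin n → X,
    rademacherAverage x ≤ 1 → (n : ℝ)⁻¹ * ∑ k, ‖x k‖ ≤ ε}

/-- `𝔔_X(ε)`, the least threshold. -/
def frakQ (X : Type u) [NormedAddCommGroup X] (ε : ℝ) : ℕ := sInf (averageThresholds X ε)

/-- `𝔭_X = inf_{0 < t < 1} log 𝔔_X(t) / log (1/t)`; all the quotients are nonnegative. -/
def frakP (X : Type u) [NormedAddCommGroup X] : ℝ :=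
  ⨅ t : Ioo (0 : ℝ) 1, Real.log (frakQ X (t : ℝ)) / Real.log (1 / (t : ℝ))

/-- `p` is a (classical) Rademacher cotype of `X`. -/
def HasRademacherCotype (X : Type u) [NormedAddCommGroup X] (p : ℝ) : Prop :=
  ∃ C : ℝ, 0 < C ∧ ∀ (n : ℕ) (x : Fin n → X),
    ∑ k, ‖x k‖ ^ p ≤ C * rademacherAverage x ^ p

end

/-! The Rademacher average equals the mean of the norm over all choices of signs, so everything
reduces to finite averages. Call `MeanNormBound X N a` the estimate "mean of `N` norms ≤ `a` · sign
average". It is submultiplicative in `(N, a)`: for `m` blocks of `n` vectors, independent block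
signs leave the sign average unchanged, so the two estimates can be applied in turn
(`MeanNormBound.mul`). Hence a single bound with `a < 1` yields constants `a ^ k → 0`, and averaging
over cyclic windows extends each bound to all larger families; all thresholds are then finite.

If no bound with `a < 1` holds, there are odd families with sign average one whose norms are all
almost one. Parity on the discrete cube forces every signed sum to have norm at most about one
(`norm_signed_sum_le`), so `X` contains real copies of `ℓ_∞ⁿ` uniformly. An ultrapower of `X`, which
is finitely representable in `X`, then contains a real copy of `c₀` and is not reflexive,
contradicting super-reflexivity.

For the cotype, `p > 𝔭_X` provides `t < 1` and `N = 𝔔_X(t)` with `N * t ^ p < 1`. In a family of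
sign average at most one, fewer than `N ^ (i + 1)` norms exceed `t ^ (i + 1)`, and summing over
these levels gives a geometric series (`MeanNormBound.sum_rpow_le`). -/

open Filter Topology
open scoped BigOperators

/-! ### Averages over signs -/

noncomputable section SignAverages

/-- The average of `‖∑ k, s k • x k‖` over all choices of signs `s`. -/
def signAverage {X : Type*} [NormedAddCommGroup X] {ι : Type*} [Fintype ι] [DecidableEq ι]
    (x : ι → X) : ℝ :=
  𝔼 s : ι → ℤˣ, ‖∑ k, s k • x k‖

/-- Marginals of uniform signs are uniform: translating by any `r` does not change the average, and
after averaging over `r` as well the original signs are absorbed. -/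
theorem expect_comp_embedding {ι κ : Type*} [Fintype ι] [DecidableEq ι] [Fintype κ]
    [DecidableEq κ] {f : κ → ι} (hf : Function.Injective f) (g : (κ → ℤˣ) → ℝ) :
    𝔼 s : ι → ℤˣ, g (fun k => s (f k)) = 𝔼 r : κ → ℤˣ, g r := by
  have key : ∀ r : κ → ℤˣ,
      𝔼 s : ι → ℤˣ, g (fun k => s (f k)) = 𝔼 s : ι → ℤˣ, g (r * fun k => s (f k)) := by
    intro r
    refine Fintype.expect_equiv (Equiv.mulLeft (Function.extend f r 1)⁻¹) _ _ fun s => ?_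
    congr 1
    ext k
    simp [hf.extend_apply, ← mul_assoc]
  calc 𝔼 s : ι → ℤˣ, g (fun k => s (f k))
      = 𝔼 _r : κ → ℤˣ, 𝔼 s : ι → ℤˣ, g (fun k => s (f k)) := (Fintype.expect_const _).symm
    _ = 𝔼 r : κ → ℤˣ, 𝔼 s : ι → ℤˣ, g (r * fun k => s (f k)) :=
        Finset.expect_congr rfl fun r _ => key r
    _ = 𝔼 s : ι → ℤˣ, 𝔼 r : κ → ℤˣ, g (r * fun k => s (f k)) := Finset.expect_comm _ _ _
    _ = 𝔼 _s : ι → ℤˣ, 𝔼 r : κ → ℤˣ, g r := Finset.expect_congr rfl fun s _ =>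
        Fintype.expect_equiv (Equiv.mulRight fun k => s (f k)) _ _ fun r => rfl
    _ = 𝔼 r : κ → ℤˣ, g r := Fintype.expect_const _

variable {X : Type*} [NormedAddCommGroup X] {ι κ : Type*} [Fintype ι] [DecidableEq ι] [Fintype κ]
    [DecidableEq κ]

theorem signAverage_comp_equiv (e : κ ≃ ι) (x : ι → X) :
    signAverage (fun k => x (e k)) = signAverage x := by
  rw [signAverage, signAverage,
    ← expect_comp_embedding e.injective fun s => ‖∑ k, s k • x (e k)‖]
  refine Finset.expect_congr rfl fun s _ => ?_
  rw [Equiv.sum_comp e fun i => s i • x i]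

theorem signAverage_nonneg (x : ι → X) : 0 ≤ signAverage x :=
  Finset.expect_nonneg fun _ _ => norm_nonneg _

/-- Multiplying each block by a further independent sign does not change the distribution. For fixed
inner signs, `hc` applies to the vector of block sums. -/
theorem sum_signAverage_le {c : ℝ} (hc : ∀ y : ι → X, ∑ i, ‖y i‖ ≤ c * signAverage y)
    (x : ι × κ → X) : ∑ i, signAverage (fun j => x (i, j)) ≤ c * signAverage x := by
  have h1 : ∀ r : ι → ℤˣ, signAverage x =
      𝔼 s : ι × κ → ℤˣ, ‖∑ i, r i • ∑ j, s (i, j) • x (i, j)‖ := by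
    intro r
    refine (Fintype.expect_equiv (Equiv.mulLeft fun p : ι × κ => r p.1) _ _ fun s => ?_).symm
    simp [Fintype.sum_prod_type, Finset.smul_sum, mul_smul]
  have h2 : signAverage x =
      𝔼 s : ι × κ → ℤˣ, signAverage fun i => ∑ j, s (i, j) • x (i, j) := by
    rw [← Fintype.expect_const (ι := ι → ℤˣ) (signAverage x)]
    simp_rw [signAverage.eq_def fun i => ∑ j, _]
    rw [Finset.expect_comm]
    exact Finset.expect_congr rfl fun r _ => h1 r
  have h3 : ∀ i, signAverage (fun j => x (i, j)) =
      𝔼 s : ι × κ → ℤˣ, ‖∑ j, s (i, j) • x (i, j)‖ := fun i =>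
    (expect_comp_embedding (f := fun j => (i, j)) (fun a b h => (Prod.ext_iff.1 h).2)
      fun s => ‖∑ j, s j • x (i, j)‖).symm
  simp_rw [h3]
  rw [h2, Finset.mul_expect, ← Finset.expect_sum_comm]
  exact Finset.expect_le_expect fun s _ => hc _

variable [NormedSpace ℝ X]

/-- Flipping all signs outside the range of `f` preserves the average, and adding the flipped sum to
the original cancels the omitted vectors and doubles the rest. -/
theorem signAverage_comp_le {f : κ → ι} (hf : Function.Injective f) (x : ι → X) :
    signAverage (fun k => x (f k)) ≤ signAverage x := by
  classical
  have h1 : signAverage (fun k => x (f k)) = 𝔼 s : ι → ℤˣ, ‖∑ k, s (f k) • x (f k)‖ :=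
    (expect_comp_embedding hf fun s => ‖∑ k, s k • x (f k)‖).symm
  set A : Finset ι := Finset.univ.map ⟨f, hf⟩
  have h2 : ∀ s : ι → ℤˣ, ∑ k, s (f k) • x (f k) = ∑ i ∈ A, s i • x i := fun s => by
    simp [A]
  let σ : ι → ℤˣ := fun i => if i ∈ A then 1 else -1
  have h3 : signAverage x = 𝔼 s : ι → ℤˣ, ‖∑ k, (σ * s) k • x k‖ :=
    (Fintype.expect_equiv (Equiv.mulLeft σ) _ _ fun s => rfl).symm
  have h4 : ∀ s : ι → ℤˣ, 2 * ‖∑ k, s (f k) • x (f k)‖ ≤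
      ‖∑ k, s k • x k‖ + ‖∑ k, (σ * s) k • x k‖ := by
    intro s
    have e : ∑ k, s k • x k + ∑ k, (σ * s) k • x k = (2 : ℝ) • ∑ k, s (f k) • x (f k) := by
      rw [h2, ← Finset.sum_add_distrib, Finset.smul_sum, ← Finset.sum_subset (Finset.subset_univ A)]
      · exact Finset.sum_congr rfl fun i hi => by simp [σ, hi, two_smul]
      · intro i _ hi
        simp [σ, hi]
    calc 2 * ‖∑ k, s (f k) • x (f k)‖ = ‖(2 : ℝ) • ∑ k, s (f k) • x (f k)‖ := by
          rw [norm_smul]; norm_num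
      _ ≤ _ := by rw [← e]; exact norm_add_le _ _
  have h5 : 2 * signAverage (fun k => x (f k)) ≤ signAverage x + signAverage x := by
    calc 2 * signAverage (fun k => x (f k))
        = 𝔼 s : ι → ℤˣ, 2 * ‖∑ k, s (f k) • x (f k)‖ := by rw [h1, Finset.mul_expect]
      _ ≤ 𝔼 s : ι → ℤˣ, (‖∑ k, s k • x k‖ + ‖∑ k, (σ * s) k • x k‖) :=
          Finset.expect_le_expect fun s _ => h4 s
      _ = _ := by rw [Finset.expect_add_distrib, ← h3]; rfl
  linarith

theorem norm_le_signAverage (x : ι → X) (i : ι) : ‖x i‖ ≤ signAverage x := by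
  have h := signAverage_comp_le (f := fun _ : Unit => i) (fun _ _ _ => rfl) x
  refine le_trans (le_of_eq ?_) h
  simp [signAverage, norm_units_zsmul]

theorem signAverage_smul (c : ℝ) (x : ι → X) :
    signAverage (fun k => c • x k) = |c| * signAverage x := by
  rw [signAverage, signAverage, Finset.mul_expect]
  refine Finset.expect_congr rfl fun s _ => ?_
  rw [← Real.norm_eq_abs, ← norm_smul, Finset.smul_sum]
  congr 1
  exact Finset.sum_congr rfl fun k _ => smul_comm _ _ _

end SignAverages

/-! ### Rademacher integrals as sign averages -/

section RademacherAverages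

theorem measurable_rademacher (k : ℕ) : Measurable (rademacher k) := by
  unfold rademacher
  exact (measurable_of_countable fun m : ℕ => (-1 : ℤ) ^ m).comp
    (Nat.measurable_floor.comp (measurable_const.mul measurable_id))

theorem rademacher_succ (k : ℕ) (t : ℝ) : rademacher (k + 1) t = rademacher k (2 * t) := by
  simp only [rademacher]
  rw [pow_succ, mul_assoc]

theorem rademacher_one_add {k : ℕ} (hk : k ≠ 0) {t : ℝ} (ht : 0 ≤ t) :
    rademacher k (1 + t) = rademacher k t := by
  simp only [rademacher]
  have : (2 : ℝ) ^ k * (1 + t) = (2 : ℝ) ^ k * t + ((2 ^ k : ℕ) : ℝ) := by push_cast; ring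
  rw [this, Nat.floor_add_natCast (by positivity), pow_add,
    Even.neg_one_pow ((Nat.even_pow.2 ⟨even_two, hk⟩) : Even (2 ^ k)), mul_one]

theorem rademacher_mem (k : ℕ) (t : ℝ) : |rademacher k t| = 1 := by
  simp [rademacher]

variable {X : Type*} [NormedAddCommGroup X]

theorem intervalIntegrable_norm_rademacher {n : ℕ} (y : X) (x : Fin n → X) (a b : ℝ) :
    IntervalIntegrable (fun t => ‖y + ∑ k : Fin n, rademacher (k + 1) t • x k‖) volume a b := by
  have hm : Measurable fun t => ‖y + ∑ k : Fin n, rademacher (k + 1) t • x k‖ :=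
    (measurable_of_countable fun r : Fin n → ℤ => ‖y + ∑ k, r k • x k‖).comp
      (measurable_pi_lambda _ fun k => measurable_rademacher _)
  refine (intervalIntegrable_const (c := ‖y‖ + ∑ k, ‖x k‖)).mono_fun hm.aestronglyMeasurable ?_
  refine Eventually.of_forall fun t => ?_
  simp only [norm_norm]
  rw [Real.norm_of_nonneg (by positivity)]
  refine (norm_add_le _ _).trans (add_le_add_right (norm_sum_le_of_le _ fun k _ => ?_) _)
  have := norm_zsmul_le (rademacher (k + 1) t) (x k)
  rwa [Int.norm_eq_abs, ← Int.cast_abs, rademacher_mem, Int.cast_one, one_mul] at this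

/-- On each half of `[0,1]` the first Rademacher function is constant, and rescaling the half turns
the others into the functions of one index less. The offset `y` absorbs `± x 0` in the induction. -/
theorem integral_norm_rademacher {n : ℕ} (y : X) (x : Fin n → X) :
    ∫ t in (0 : ℝ)..1, ‖y + ∑ k : Fin n, rademacher (k + 1) t • x k‖ =
      𝔼 s : Fin n → ℤˣ, ‖y + ∑ k, s k • x k‖ := by
  induction n generalizing y with
  | zero => simp
  | succ n ih =>
    have hI := intervalIntegrable_norm_rademacher y x
    set F : ℝ → ℝ := fun t => ‖y + ∑ k : Fin (n + 1), rademacher (k + 1) t • x k‖ with hF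
    have hl : ∫ t in (0 : ℝ)..(1 / 2), F t = 2⁻¹ *
        ∫ t in (0 : ℝ)..1, ‖(y + x 0) + ∑ k : Fin n, rademacher (k + 1) t • x k.succ‖ := by
      have := intervalIntegral.integral_comp_mul_left
        (fun t => ‖(y + x 0) + ∑ k : Fin n, rademacher (k + 1) t • x k.succ‖)
        (a := 0) (b := 1 / 2) (c := (2 : ℝ)) two_ne_zero
      rw [mul_zero, mul_one_div_cancel two_ne_zero, smul_eq_mul] at this
      rw [← this]
      refine intervalIntegral.integral_congr_Ioo_of_le (by norm_num) fun t ht => ?_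
      have h0 : rademacher 1 t = 1 := by
        have : ⌊(2 : ℝ) * t⌋₊ = 0 := Nat.floor_eq_zero.2 (by linarith [ht.2])
        simp [rademacher, this]
      have hs : ∀ k : Fin n, rademacher (k.succ + 1) t = rademacher (k + 1) (2 * t) :=
        fun k => rademacher_succ (k + 1) t
      simp only [hF, Fin.sum_univ_succ, hs, Fin.val_zero, zero_add, h0, one_smul, add_assoc]
    have hr : ∫ t in (1 / 2 : ℝ)..1, F t = 2⁻¹ *
        ∫ t in (0 : ℝ)..1, ‖(y - x 0) + ∑ k : Fin n, rademacher (k + 1) t • x k.succ‖ := by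
      have := intervalIntegral.integral_comp_mul_sub
        (fun t => ‖(y - x 0) + ∑ k : Fin n, rademacher (k + 1) t • x k.succ‖)
        (a := 1 / 2) (b := 1) (c := (2 : ℝ)) two_ne_zero 1
      norm_num at this
      norm_num
      rw [← this]
      refine intervalIntegral.integral_congr_Ioo_of_le (by norm_num) fun t ht => ?_
      have h0 : rademacher 1 t = -1 := by
        have : ⌊(2 : ℝ) * t⌋₊ = 1 := by
          rw [Nat.floor_eq_iff (by linarith [ht.1])]
          constructor <;> push_cast <;> linarith [ht.1, ht.2]
        simp [rademacher, this]
      have hs : ∀ k : Fin n, rademacher (k.succ + 1) t = rademacher (k + 1) (2 * t - 1) := by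
        intro k
        rw [Fin.val_succ, rademacher_succ, ← rademacher_one_add (Nat.succ_ne_zero k) (by linarith [ht.1] : 0 ≤ 2 * t - 1)]
        congr 1; ring
      simp only [hF, Fin.sum_univ_succ, hs, Fin.val_zero, zero_add, h0, neg_smul, one_smul,
        add_assoc, sub_eq_add_neg]
    rw [← intervalIntegral.integral_add_adjacent_intervals (hI 0 (1 / 2)) (hI (1 / 2) 1), hl, hr,
      ih, ih, Fintype.expect_equiv (Fin.consEquiv fun _ : Fin (n + 1) => ℤˣ).symm _
        (fun p : ℤˣ × (Fin n → ℤˣ) => ‖y + (p.1 • x 0 + ∑ k : Fin n, p.2 k • x k.succ)‖)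
        (fun s => by rw [Fin.sum_univ_succ]; rfl),
      ← Finset.univ_product_univ, Finset.expect_product]
    have hu : (Finset.univ : Finset ℤˣ) = {1, -1} := rfl
    rw [hu, Finset.expect_eq_sum_div_card {1, -1}, Finset.sum_pair (by decide),
      Finset.card_pair (by decide)]
    simp only [one_smul, Units.neg_smul, add_assoc, sub_eq_add_neg]
    push_cast
    ring

theorem rademacherAverage_eq {X : Type u} [NormedAddCommGroup X] {n : ℕ} (x : Fin n → X) :
    rademacherAverage x = signAverage x := by
  simpa [rademacherAverage, signAverage] using integral_norm_rademacher 0 x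

end RademacherAverages

/-! ### Mean norm bounds: submultiplicativity and level counting -/

section AverageBounds

/-- The mean of the norms of any `n` vectors is at most `a` times their sign average. -/
def MeanNormBound (X : Type*) [NormedAddCommGroup X] (n : ℕ) (a : ℝ) : Prop :=
  ∀ x : Fin n → X, ∑ k, ‖x k‖ ≤ n * a * signAverage x

variable {X : Type*} [NormedAddCommGroup X]

theorem MeanNormBound.sum_le {n : ℕ} {a : ℝ} (h : MeanNormBound X n a) {ι : Type*} [Fintype ι]
    [DecidableEq ι] (hι : Fintype.card ι = n) (x : ι → X) :
    ∑ k, ‖x k‖ ≤ n * a * signAverage x := by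
  have e := (Fintype.equivFinOfCardEq hι).symm
  rw [← signAverage_comp_equiv e, ← Equiv.sum_comp e fun i => ‖x i‖]
  exact h _

theorem MeanNormBound.mul {m n : ℕ} {a b : ℝ} (hm : MeanNormBound X m a)
    (hn : MeanNormBound X n b) (hb : 0 ≤ b) : MeanNormBound X (m * n) (a * b) := by
  intro x
  set e : Fin m × Fin n ≃ Fin (m * n) := finProdFinEquiv
  rw [← signAverage_comp_equiv e, ← Equiv.sum_comp e fun i => ‖x i‖, Fintype.sum_prod_type]
  calc ∑ i, ∑ j, ‖x (e (i, j))‖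
      ≤ ∑ i, n * b * signAverage fun j => x (e (i, j)) := Finset.sum_le_sum fun i _ => hn _
    _ = n * b * ∑ i, signAverage fun j => x (e (i, j)) := by rw [Finset.mul_sum]
    _ ≤ n * b * (m * a * signAverage fun p => x (e p)) :=
        mul_le_mul_of_nonneg_left (sum_signAverage_le hm fun p => x (e p)) (by positivity)
    _ = _ := by push_cast; ring

variable [NormedSpace ℝ X]

theorem MeanNormBound.pow {n : ℕ} {a : ℝ} (h : MeanNormBound X n a) (ha : 0 ≤ a) (k : ℕ) :
    MeanNormBound X (n ^ k) (a ^ k) := by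
  induction k with
  | zero =>
    rw [pow_zero, pow_zero]
    intro x
    simpa using norm_le_signAverage x 0
  | succ k ih => exact ih.mul h ha

/-- Each of the `n` vectors lies in exactly `m` of the `n` cyclic windows of length `m`; the bounds
for the windows are summed. -/
theorem MeanNormBound.mono {m n : ℕ} {a : ℝ} (h : MeanNormBound X m a) (ha : 0 ≤ a) (hm : 1 ≤ m)
    (hmn : m ≤ n) : MeanNormBound X n a := by
  intro x
  have : NeZero n := ⟨by omega⟩
  have h1 : ∑ j : Fin n, ∑ k : Fin m, ‖x (j + Fin.castLE hmn k)‖ = m * ∑ k, ‖x k‖ := by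
    rw [Finset.sum_comm]
    have : ∀ k : Fin m, ∑ j : Fin n, ‖x (j + Fin.castLE hmn k)‖ = ∑ j, ‖x j‖ := fun k =>
      Equiv.sum_comp (Equiv.addRight (Fin.castLE hmn k)) fun j => ‖x j‖
    simp [this]
  have h2 : ∀ j : Fin n, ∑ k : Fin m, ‖x (j + Fin.castLE hmn k)‖ ≤ m * a * signAverage x := by
    intro j
    refine (h _).trans (mul_le_mul_of_nonneg_left ?_ (by positivity))
    exact signAverage_comp_le (f := fun k => j + Fin.castLE hmn k)
      ((add_right_injective j).comp (Fin.castLE_injective hmn)) x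
  have h3 : (m : ℝ) * ∑ k, ‖x k‖ ≤ m * (n * a * signAverage x) := by
    rw [← h1]
    refine (Finset.sum_le_sum fun j _ => h2 j).trans (le_of_eq ?_)
    simp
    ring
  exact le_of_mul_le_mul_left h3 (by positivity)

/-- Under a mean norm bound, few vectors of a normalized family can have large norm. -/
theorem MeanNormBound.card_lt {N : ℕ} {a : ℝ} (h : MeanNormBound X N a) (ha : 0 ≤ a) (hN : 1 ≤ N)
    {n : ℕ} {x : Fin n → X} (hx : signAverage x ≤ 1) (A : Finset (Fin n))
    (hA : ∀ k ∈ A, a < ‖x k‖) : A.card < N := by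
  by_contra! hc
  obtain ⟨B, hBA, hB⟩ := Finset.exists_subset_card_eq hc
  have h1 := h.sum_le (ι := B) (by simpa using hB) fun k => x k
  have h2 : signAverage (fun k : B => x k) ≤ 1 :=
    (signAverage_comp_le Subtype.val_injective x).trans hx
  have h3 : ∑ _k : B, a < ∑ k : B, ‖x k‖ := by
    refine Finset.sum_lt_sum_of_nonempty ?_ fun k _ => hA k (hBA k.2)
    rw [Finset.univ_nonempty_iff, ← Fintype.card_pos_iff, Fintype.card_coe]
    omega
  simp only [Finset.sum_const, Finset.card_univ, Fintype.card_coe, hB, nsmul_eq_mul] at h3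
  nlinarith [mul_le_mul_of_nonneg_left h2 (by positivity : 0 ≤ (N : ℝ) * a)]

/-- The vectors are sorted into levels `t ^ (i + 1) < ‖x k‖ ≤ t ^ i`. Each level contributes at most
`N ^ (i + 1) * (t ^ p) ^ i`, a geometric term of ratio `N * t ^ p`. -/
theorem MeanNormBound.sum_rpow_le {N : ℕ} {t p : ℝ} (h : MeanNormBound X N t) (hN : 1 ≤ N)
    (ht0 : 0 < t) (ht1 : t < 1) (hp : 0 < p) (hNp : N * t ^ p < 1) {n : ℕ} (x : Fin n → X)
    (hx : signAverage x ≤ 1) : ∑ k, ‖x k‖ ^ p ≤ N * (1 - N * t ^ p)⁻¹ := by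
  classical
  -- A zero vector has no level; its `j` is arbitrary and it is left out of `S` below.
  have hex : ∀ k, ∃ j : ℕ, x k ≠ 0 → t ^ (j + 1) < ‖x k‖ ∧ ‖x k‖ ≤ t ^ j := by
    intro k
    by_cases hk : x k = 0
    · exact ⟨0, fun h => absurd hk h⟩
    · obtain ⟨j, hj⟩ := exists_nat_pow_near_of_lt_one (norm_pos_iff.2 hk)
        ((norm_le_signAverage x k).trans hx) ht0 ht1
      exact ⟨j, fun _ => hj⟩
  choose j hj using hex
  set S : Finset (Fin n) := Finset.univ.filter fun k => x k ≠ 0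
  have hS : ∀ k ∈ S, x k ≠ 0 := fun k hk => (Finset.mem_filter.1 hk).2
  set q : ℝ := N * t ^ p with hq
  have hq0 : 0 ≤ q := by positivity
  calc ∑ k, ‖x k‖ ^ p = ∑ k ∈ S, ‖x k‖ ^ p := by
        refine (Finset.sum_subset (Finset.subset_univ S) fun k _ hk => ?_).symm
        have : x k = 0 := by simpa [S] using hk
        rw [this, norm_zero, Real.zero_rpow hp.ne']
    _ ≤ ∑ k ∈ S, (t ^ p) ^ j k := by
        refine Finset.sum_le_sum fun k hk => ?_
        rw [← Real.rpow_natCast, ← Real.rpow_mul ht0.le, mul_comm p, Real.rpow_mul ht0.le,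
          Real.rpow_natCast]
        exact Real.rpow_le_rpow (norm_nonneg _) (hj k (hS k hk)).2 hp.le
    _ = ∑ i ∈ S.image j, (S.filter fun k => j k = i).card • (t ^ p) ^ i :=
        Finset.sum_comp (fun i => (t ^ p) ^ i) j
    _ ≤ ∑ i ∈ S.image j, N * q ^ i := by
        refine Finset.sum_le_sum fun i _ => ?_
        -- The power `i + 1` of the bound has constant exactly `t ^ (i + 1)`, the lower edge of the
        -- level.
        have hc : (S.filter fun k => j k = i).card < N ^ (i + 1) := by
          refine (h.pow ht0.le (i + 1)).card_lt (by positivity) (Nat.one_le_pow _ _ hN) hx _ ?_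
          intro k hk
          obtain ⟨hk1, rfl⟩ := Finset.mem_filter.1 hk
          exact (hj k (hS k hk1)).1
        have hc' : ((S.filter fun k => j k = i).card : ℝ) ≤ (N : ℝ) ^ (i + 1) := by
          exact_mod_cast hc.le
        rw [nsmul_eq_mul, hq, mul_pow, ← mul_assoc, ← pow_succ']
        gcongr
    _ = N * ∑ i ∈ S.image j, q ^ i := by rw [Finset.mul_sum]
    _ ≤ N * (1 - q)⁻¹ := by
        rw [← tsum_geometric_of_lt_one hq0 hNp]
        gcongr
        exact (summable_geometric_of_lt_one hq0 hNp).sum_le_tsum _ fun i _ => by positivity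

end AverageBounds

/-! ### Finite thresholds and the passage to cotype -/

section Thresholds

variable {X : Type u} [NormedAddCommGroup X] [NormedSpace ℝ X]

theorem signAverage_eq_zero {ι : Type*} [Fintype ι] [DecidableEq ι] {x : ι → X}
    (h : signAverage x = 0) (k : ι) : x k = 0 :=
  norm_le_zero_iff.1 ((norm_le_signAverage x k).trans h.le)

theorem signAverage_normalize {ι : Type*} [Fintype ι] [DecidableEq ι] {x : ι → X}
    (h : 0 < signAverage x) : signAverage (fun k => (signAverage x)⁻¹ • x k) = 1 := by
  rw [signAverage_smul, abs_of_pos (inv_pos.2 h), inv_mul_cancel₀ h.ne']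

theorem MeanNormBound.of_mem_averageThresholds {t : ℝ} {N n : ℕ}
    (hN : N ∈ averageThresholds X t) (hn : N ≤ n) : MeanNormBound X n t := by
  intro x
  rcases (signAverage_nonneg x).eq_or_lt with h0 | h0
  · simp [signAverage_eq_zero h0.symm, ← h0]
  · have h1 := hN.2 n hn (fun k => (signAverage x)⁻¹ • x k)
      (by rw [rademacherAverage_eq, signAverage_normalize h0])
    have hn0 : (0 : ℝ) < n := by exact_mod_cast hN.1.trans hn
    simp only [norm_smul, norm_inv, Real.norm_of_nonneg h0.le, ← Finset.mul_sum] at h1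
    rw [inv_mul_le_iff₀ hn0, inv_mul_le_iff₀ h0] at h1
    linarith

theorem mem_averageThresholds {t : ℝ} {N : ℕ} (ht : 0 ≤ t) (hN : 1 ≤ N)
    (h : MeanNormBound X N t) : N ∈ averageThresholds X t := by
  refine ⟨hN, fun n hn x hx => ?_⟩
  rw [rademacherAverage_eq] at hx
  have hn0 : (0 : ℝ) < n := by exact_mod_cast hN.trans hn
  rw [inv_mul_le_iff₀ hn0]
  have := h.mono ht hN hn x
  nlinarith [mul_le_mul_of_nonneg_left hx (by positivity : 0 ≤ (n : ℝ) * t)]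

theorem averageThresholds_nonempty {N : ℕ} {a : ℝ} (h : MeanNormBound X N a) (hN : 1 ≤ N)
    (ha0 : 0 ≤ a) (ha1 : a < 1) {t : ℝ} (ht : 0 < t) : (averageThresholds X t).Nonempty := by
  obtain ⟨k, hk⟩ := exists_pow_lt_of_lt_one ht ha1
  refine ⟨N ^ k, mem_averageThresholds ht.le (Nat.one_le_pow _ _ hN) fun x => ?_⟩
  refine (h.pow ha0 k x).trans ?_
  have := signAverage_nonneg x
  gcongr

theorem hasRademacherCotype_of_frakP_lt
    (hne : ∀ t : ℝ, 0 < t → t ≤ 1 → (averageThresholds X t).Nonempty) {p : ℝ}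
    (hp : frakP X < p) : HasRademacherCotype X p := by
  have hp0 : 0 < p := by
    refine lt_of_le_of_lt (Real.iInf_nonneg fun t => ?_) hp
    exact div_nonneg (Real.log_natCast_nonneg _)
      (Real.log_nonneg (by rw [le_div_iff₀ t.2.1]; linarith [t.2.2]))
  have : Nonempty (Ioo (0 : ℝ) 1) := ⟨⟨1 / 2, by norm_num, by norm_num⟩⟩
  obtain ⟨⟨t, ht0, ht1⟩, ht⟩ := exists_lt_of_ciInf_lt hp
  set N := frakQ X t
  -- Nonemptiness matters here: the infimum of an empty set of naturals would be the junk value `0`.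
  have hN : N ∈ averageThresholds X t := Nat.sInf_mem (hne t ht0 ht1.le)
  have hN0 : (0 : ℝ) < N := by exact_mod_cast hN.1
  have hlog : 0 < Real.log (1 / t) := Real.log_pos (by rw [lt_div_iff₀ ht0]; linarith)
  -- This is `log N / log (1 / t) < p` exponentiated.
  have hNp : N * t ^ p < 1 := by
    rw [div_lt_iff₀ hlog, one_div, Real.log_inv] at ht
    rw [← Real.log_neg_iff (by positivity), Real.log_mul hN0.ne' (by positivity),
      Real.log_rpow ht0]
    linarith
  have hbd := MeanNormBound.of_mem_averageThresholds hN le_rfl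
  refine ⟨N * (1 - N * t ^ p)⁻¹, mul_pos hN0 (inv_pos.2 (by linarith)), fun n x => ?_⟩
  rw [rademacherAverage_eq]
  rcases (signAverage_nonneg x).eq_or_lt with h0 | h0
  · simp [signAverage_eq_zero h0.symm, ← h0, Real.zero_rpow hp0.ne']
  · have := hbd.sum_rpow_le hN.1 ht0 ht1 hp0 hNp _ (signAverage_normalize h0).le
    simp only [norm_smul, norm_inv, Real.norm_of_nonneg h0.le,
      Real.mul_rpow (inv_nonneg.2 h0.le) (norm_nonneg _), ← Finset.mul_sum,
      Real.inv_rpow h0.le] at this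
    rwa [inv_mul_le_iff₀ (Real.rpow_pos_of_pos h0 p), mul_comm (signAverage x ^ p)] at this

end Thresholds

/-! ### Extremal families and copies of finite-dimensional cubes -/

section Cubes

variable {X : Type*} [NormedAddCommGroup X] [NormedSpace ℝ X]

/-- The cube `[-1,1]^ι` is the convex hull of the sign vectors, and the preimage of a ball is
convex. -/
theorem norm_sum_smul_le_of_signs {ι : Type*} [Fintype ι] {x : ι → X} {C : ℝ}
    (h : ∀ s : ι → ℤˣ, ‖∑ k, s k • x k‖ ≤ C) {b : ι → ℝ} (hb : ∀ k, |b k| ≤ 1) :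
    ‖∑ k, b k • x k‖ ≤ C := by
  let L : (ι → ℝ) →ₗ[ℝ] X := Fintype.linearCombination ℝ x
  have hconv : Convex ℝ (L ⁻¹' Metric.closedBall 0 C) :=
    (convex_closedBall (0 : X) C).linear_preimage L
  have hsub : univ.pi (fun _ : ι => ({-1, 1} : Set ℝ)) ⊆ L ⁻¹' Metric.closedBall 0 C := by
    intro c hc
    have : ∀ k, ∃ s : ℤˣ, ∀ y : X, c k • y = s • y := by
      intro k
      rcases hc k (mem_univ k) with hk | hk
      · exact ⟨-1, fun y => by simp [hk]⟩
      · exact ⟨1, fun y => by simp [mem_singleton_iff.1 hk]⟩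
    choose s hs using this
    simpa [L, Fintype.linearCombination_apply, hs] using h s
  have hmem : b ∈ convexHull ℝ (univ.pi fun _ : ι => ({-1, 1} : Set ℝ)) := by
    rw [convexHull_pi]
    intro k _
    rw [convexHull_pair, segment_eq_Icc (by norm_num)]
    exact abs_le.1 (hb k)
  simpa [L, Fintype.linearCombination_apply] using convexHull_min hsub hconv hmem

/-- If an odd number of almost-unit vectors has sign average one, then all signed sums almost have
norm one: the deviation from one is nearly alternating along edges of the cube and it is even. -/
theorem norm_signed_sum_le {ι : Type*} [Fintype ι] [DecidableEq ι] (hodd : Odd (Fintype.card ι))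
    {η : ℝ} {x : ι → X} (hE : signAverage x = 1) (hx : ∀ k, 1 - η ≤ ‖x k‖) (s : ι → ℤˣ) :
    ‖∑ k, s k • x k‖ ≤ 1 + Fintype.card ι * 2 ^ Fintype.card ι * η := by
  obtain ⟨g, hg⟩ : ∃ g : (ι → ℤˣ) → ℝ, ∀ s, g s = ‖∑ k, s k • x k‖ - 1 := ⟨_, fun _ => rfl⟩
  let τ : ι → ι → ℤˣ := fun k => Pi.mulSingle k (-1)
  set M : ℝ := 2 ^ Fintype.card ι * (2 * η) with hM
  have hcard : (Finset.univ : Finset (ι → ℤˣ)).card = 2 ^ Fintype.card ι := by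
    simp [Fintype.card_units_int]
  have hsum : ∑ s, g s = 0 := by
    rw [signAverage, Finset.expect_eq_sum_div_card, div_eq_one_iff_eq (by simp)] at hE
    rw [Finset.sum_congr rfl fun s _ => hg s, Finset.sum_sub_distrib, hE]
    simp
  -- The two signed sums differ by `± 2 x k`, so their norms add up to at least `2 ‖x k‖`.
  have hlow : ∀ k s, -(2 * η) ≤ g s + g (τ k * s) := by
    intro k s
    have e : ∑ i, s i • x i - ∑ i, (τ k * s) i • x i =
        (2 : ℝ) • (s k • x k) := by
      rw [← Finset.sum_sub_distrib, Finset.sum_eq_single k]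
      · simp [τ, two_smul]
      · intro i _ hi
        simp [τ, Pi.mulSingle_eq_of_ne hi]
      · simp
    have h1 := norm_sub_le (∑ i, s i • x i) (∑ i, (τ k * s) i • x i)
    rw [e, norm_smul, norm_units_zsmul, Real.norm_ofNat] at h1
    rw [hg, hg]
    linarith [hx k]
  -- The quantities `g s + g (τ k * s) + 2 * η` are nonnegative with total `M`, because `g` sums to
  -- zero; so each is at most `M`.
  have hup : ∀ k s, g s + g (τ k * s) ≤ M - 2 * η := by
    intro k s
    have h1 : g s + g (τ k * s) + 2 * η ≤
        ∑ s, (g s + g (τ k * s) + 2 * η) :=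
      Finset.single_le_sum (f := fun s => g s + g (τ k * s) + 2 * η)
        (fun s _ => neg_le_iff_add_nonneg.1 (hlow k s)) (Finset.mem_univ s)
    have h2 : ∑ s, g (τ k * s) = ∑ s, g s :=
      Equiv.sum_comp (Equiv.mulLeft (τ k)) g
    have h3 : ∑ _s : ι → ℤˣ, 2 * η = M := by
      rw [Finset.sum_const, hcard, nsmul_eq_mul, Nat.cast_pow, Nat.cast_ofNat]
    rw [Finset.sum_add_distrib, Finset.sum_add_distrib, h2, hsum, h3] at h1
    linarith
  have hη : ∀ _k : ι, 0 ≤ η := fun k => by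
    linarith [(hx k).trans ((norm_le_signAverage x k).trans hE.le)]
  have hedge : ∀ k s, |g s + g (τ k * s)| ≤ M := by
    intro k s
    have h0 := hη k
    have h1 : (1 : ℝ) ≤ 2 ^ Fintype.card ι := one_le_pow₀ (by norm_num)
    rw [abs_le]
    constructor <;> nlinarith [hlow k s, hup k s]
  have hpath : ∀ (A : Finset ι) (s : ι → ℤˣ),
      |g s - (-1) ^ A.card * g ((∏ k ∈ A, τ k) * s)| ≤ A.card * M := by
    intro A
    induction A using Finset.induction_on with
    | empty => simp
    | insert k A hk ih =>
      intro s
      rw [Finset.prod_insert hk, Finset.card_insert_of_notMem hk, mul_assoc, pow_succ]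
      have h1 := hedge k ((∏ k ∈ A, τ k) * s)
      have h2 := ih s
      push_cast
      rcases neg_one_pow_eq_or ℝ A.card with h | h <;> rw [h] at h2 ⊢ <;> rw [abs_le] at * <;>
        constructor <;> linarith [h1.1, h1.2, h2.1, h2.2]
  -- Flipping all coordinates leads from `s` to `-s`, where `g` takes the same value; since the
  -- number of flips is odd, `2 * g s` is at most card `ι` times `M`.
  have h1 := hpath Finset.univ s
  have h2 : (∏ k : ι, τ k) = (-1 : ι → ℤˣ) := Finset.univ_prod_mulSingle (-1)
  have h3 : g (-s) = g s := by simp [hg, Finset.sum_neg_distrib]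
  rw [h2, neg_one_mul, h3, Finset.card_univ, hodd.neg_one_pow] at h1
  have h4 := hg s
  have h5 := (abs_le.1 h1).2
  rw [hM] at h5
  linarith

/-- If no mean norm bound has constant below one, then `X` contains real copies of `ℓ_∞ⁿ`. -/
theorem exists_cube_basis (h : ∀ N : ℕ, 1 ≤ N → ∀ a : ℝ, 0 ≤ a → a < 1 → ¬ MeanNormBound X N a)
    (n : ℕ) : ∃ x : ℕ → X, ∀ b : ℕ → ℝ, (∀ k, |b k| ≤ 1) →
      ‖∑ k ∈ Finset.range n, b k • x k‖ ≤ 2 ∧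
        ∀ j < n, |b j| = 1 → 1 / 2 ≤ ‖∑ k ∈ Finset.range n, b k • x k‖ := by
  -- Any odd number at least `n` would serve; only the first `n` vectors are kept.
  set N := 2 * n + 1 with hN
  have hN0 : (1 : ℝ) ≤ N := by exact_mod_cast (by omega : 1 ≤ N)
  have hp : (1 : ℝ) ≤ 2 ^ N := one_le_pow₀ (by norm_num)
  -- Chosen so that all signed sums have norm at most `1 + 1/8`.
  set η : ℝ := (8 * (N * 2 ^ N))⁻¹ with hη
  have hη0 : 0 < η := by positivity
  have hη1 : η ≤ 1 / 8 := by
    rw [hη, one_div]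
    gcongr
    nlinarith
  have hηN : N * 2 ^ N * η = 1 / 8 := by
    rw [hη]; field_simp
  have hδ : η / N ≤ 1 / 8 := (div_le_self hη0.le hN0).trans hη1
  have hδ0 : 0 < η / N := by positivity
  -- A deficit below `η / N` in the mean is one below `η` in the sum; as no norm exceeds one, every
  -- single norm is then at least `1 - η`.
  have hno := h N (by omega) (1 - η / N) (by linarith) (by linarith)
  rw [MeanNormBound] at hno
  push Not at hno
  obtain ⟨z, hz⟩ := hno
  have hz0 : 0 < signAverage z := by
    refine (signAverage_nonneg z).lt_of_ne fun h0 => ?_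
    simp [signAverage_eq_zero h0.symm, ← h0] at hz
  set y : Fin N → X := fun k => (signAverage z)⁻¹ • z k
  have hy : signAverage y = 1 := signAverage_normalize hz0
  have hsum : N - η < ∑ k, ‖y k‖ := by
    simp only [y, norm_smul, norm_inv, Real.norm_of_nonneg hz0.le, ← Finset.mul_sum]
    rw [lt_inv_mul_iff₀ hz0]
    refine lt_of_le_of_lt (le_of_eq ?_) hz
    field_simp
  have hyk : ∀ k, 1 - η ≤ ‖y k‖ := by
    intro k
    have h1 : ∑ i ∈ Finset.univ.erase k, ‖y i‖ ≤ (N - 1 : ℝ) := by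
      refine (Finset.sum_le_card_nsmul _ _ 1 fun i _ =>
        (norm_le_signAverage y i).trans hy.le).trans ?_
      simp [hN]
    have h2 := Finset.add_sum_erase Finset.univ (fun i => ‖y i‖) (Finset.mem_univ k)
    linarith
  have hC : ∀ b : Fin N → ℝ, (∀ k, |b k| ≤ 1) → ‖∑ k, b k • y k‖ ≤ 9 / 8 := by
    intro b hb
    refine norm_sum_smul_le_of_signs (fun s => ?_) hb
    have := norm_signed_sum_le (by rw [Fintype.card_fin]; exact ⟨n, hN⟩) hy hyk s
    rw [Fintype.card_fin, hηN] at this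
    linarith
  refine ⟨fun k => if hk : k < N then y ⟨k, hk⟩ else 0, fun b hb => ?_⟩
  have hext : ∀ c : ℕ → ℝ, ∑ k ∈ Finset.range n, c k • (if hk : k < N then y ⟨k, hk⟩ else 0) =
      ∑ k : Fin N, (if (k : ℕ) < n then c k else 0) • y k := by
    intro c
    rw [Finset.sum_fin_eq_sum_range, ← Finset.sum_subset
      (Finset.range_mono (by omega : n ≤ N)) (fun k _ hk => ?_)]
    · refine Finset.sum_congr rfl fun k hk => ?_
      have hk' := Finset.mem_range.1 hk
      simp [hk', (by omega : k < N)]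
    · simp at hk
      simp [not_lt.2 hk]
  rw [hext]
  set c : Fin N → ℝ := fun k => if (k : ℕ) < n then b k else 0 with hc
  have hcb : ∀ k, |c k| ≤ 1 := by
    intro k
    simp only [hc]
    split_ifs
    · exact hb k
    · simp
  refine ⟨(hC c hcb).trans (by norm_num), fun j hj hbj => ?_⟩
  set J : Fin N := ⟨j, by omega⟩
  have hcJ : |c J| = 1 := by simp [hc, J, hj, hbj]
  -- Negating every coefficient except the one at `J` and adding leaves `2 c J • y J`, of norm at
  -- least `7/4`; subtracting the upper bound `9/8` leaves more than `1/2`.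
  have h1 := hC (Function.update (-c) J (c J)) fun k => by
    rcases eq_or_ne k J with rfl | hk
    · simpa using hcb _
    · simpa [hk] using hcb k
  have e : ∑ k, c k • y k + ∑ k, (Function.update (-c) J (c J)) k • y k =
      (2 : ℝ) • (c J • y J) := by
    rw [← Finset.sum_add_distrib, Finset.sum_eq_single J]
    · simp [two_smul]
    · intro i _ hi
      simp [hi]
    · simp
  have h2 := norm_add_le (∑ k, c k • y k) (∑ k, (Function.update (-c) J (c J)) k • y k)
  rw [e, norm_smul, norm_smul, Real.norm_ofNat, Real.norm_eq_abs, hcJ] at h2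
  linarith [hyk J]

end Cubes

/-! ### Banach ultrapowers and finite representability -/

noncomputable section Ultrapowers

open scoped ENNReal

variable (𝕜 : Type v) [RCLike 𝕜] (X : Type u) [NormedAddCommGroup X] [NormedSpace 𝕜 X]
  (U : Ultrafilter ℕ)

/-- The bounded sequences in `X` that tend to zero along `U`. -/
def nullSequences : Submodule 𝕜 (lp (fun _ : ℕ => X) ∞) where
  carrier := {f | Tendsto (fun n => f n) U (𝓝 0)}
  zero_mem' := by simp
  add_mem' {f g} hf hg := by simpa using Tendsto.add hf hg
  smul_mem' c f hf := by simpa using Tendsto.const_smul hf c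

variable {X}

theorem mem_nullSequences {f : lp (fun _ : ℕ => X) ∞} :
    f ∈ nullSequences 𝕜 X U ↔ Tendsto (fun n => f n) U (𝓝 0) := Iff.rfl

instance isClosed_nullSequences :
    IsClosed (nullSequences 𝕜 X U : Set (lp (fun _ : ℕ => X) ∞)) := by
  refine isClosed_of_closure_subset fun f hf => ?_
  rw [SetLike.mem_coe, mem_nullSequences, Metric.tendsto_nhds]
  intro ε hε
  obtain ⟨g, hg, hfg⟩ := Metric.mem_closure_iff.1 hf (ε / 2) (by positivity)
  have hg' := Metric.tendsto_nhds.1 ((mem_nullSequences 𝕜 U).1 hg) (ε / 2) (by positivity)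
  filter_upwards [hg'] with n hn
  rw [dist_zero_right] at hn ⊢
  have h1 : ‖f n - g n‖ ≤ ‖f - g‖ := lp.norm_apply_le_norm ENNReal.top_ne_zero (f - g) n
  rw [dist_eq_norm] at hfg
  linarith [norm_le_norm_add_norm_sub' (f n) (g n)]

variable (X)

/-- The ultrapower of `X` along `U`. -/
abbrev BanachUltrapower : Type u := lp (fun _ : ℕ => X) ∞ ⧸ nullSequences 𝕜 X U

/-- The class of a bounded sequence in the ultrapower. -/
def toUltrapower : lp (fun _ : ℕ => X) ∞ →ₗ[𝕜] BanachUltrapower 𝕜 X U :=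
  (nullSequences 𝕜 X U).mkQ

theorem toUltrapower_surjective : Function.Surjective (toUltrapower 𝕜 X U) :=
  (nullSequences 𝕜 X U).mkQ_surjective

variable {X}

theorem toUltrapower_eq_iff {f g : lp (fun _ : ℕ => X) ∞} :
    toUltrapower 𝕜 X U f = toUltrapower 𝕜 X U g ↔ Tendsto (fun n => f n - g n) U (𝓝 0) :=
  Submodule.Quotient.eq _

theorem norm_toUltrapower_le (f : lp (fun _ : ℕ => X) ∞) : ‖toUltrapower 𝕜 X U f‖ ≤ ‖f‖ :=
  Submodule.Quotient.norm_mk_le _ f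

theorem exists_toUltrapower_eq_norm_lt (f : lp (fun _ : ℕ => X) ∞) {c : ℝ}
    (hc : ‖toUltrapower 𝕜 X U f‖ < c) :
    ∃ g, toUltrapower 𝕜 X U f = toUltrapower 𝕜 X U g ∧ ‖g‖ < c := by
  obtain ⟨g, hg, hgc⟩ := Submodule.Quotient.norm_mk_lt (S := nullSequences 𝕜 X U)
    (toUltrapower 𝕜 X U f) (sub_pos.2 hc)
  exact ⟨g, hg.symm, by linarith⟩

/-- If `‖f n‖ ≤ c` for `U`-most `n`, replacing the other entries by zero keeps the class and gives a
representative of norm at most `c`. Conversely, a representative of almost minimal norm differs from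
`f` by a null sequence. -/
theorem tendsto_norm_toUltrapower (f : lp (fun _ : ℕ => X) ∞) :
    Tendsto (fun n => ‖f n‖) U (𝓝 ‖toUltrapower 𝕜 X U f‖) := by
  rw [tendsto_order]
  constructor
  · intro c hc
    by_contra hne
    have hle : ∀ᶠ n in (U : Filter ℕ), ‖f n‖ ≤ c := by
      simpa using Ultrafilter.eventually_not.2 hne
    have hc0 : 0 ≤ c := (hle.exists.elim fun n hn => (norm_nonneg _).trans hn)
    let g : lp (fun _ : ℕ => X) ∞ := ⟨fun n => if ‖f n‖ ≤ c then f n else 0, memℓp_infty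
      ⟨c, by rintro _ ⟨n, rfl⟩; dsimp only; split_ifs with h; exacts [h, by simpa using hc0]⟩⟩
    have hg : ‖g‖ ≤ c := lp.norm_le_of_forall_le hc0 fun n => by
      change ‖if ‖f n‖ ≤ c then f n else 0‖ ≤ c
      split_ifs with h
      exacts [h, by simpa using hc0]
    have hfg : toUltrapower 𝕜 X U f = toUltrapower 𝕜 X U g := by
      refine (toUltrapower_eq_iff 𝕜 U).2 ?_
      refine tendsto_const_nhds.congr' (hle.mono fun n hn => ?_)
      change 0 = f n - if ‖f n‖ ≤ c then f n else 0
      rw [if_pos hn, sub_self]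
    rw [hfg] at hc
    exact absurd (hc.trans_le (norm_toUltrapower_le 𝕜 U g)) (not_lt.2 hg)
  · intro c hc
    obtain ⟨g, hg, hgc⟩ := exists_toUltrapower_eq_norm_lt 𝕜 U f hc
    have hn := Metric.tendsto_nhds.1 ((toUltrapower_eq_iff 𝕜 U).1 hg) _ (sub_pos.2 hgc)
    filter_upwards [hn] with n hn
    rw [dist_zero_right] at hn
    have h1 : ‖g n‖ ≤ ‖g‖ := lp.norm_apply_le_norm ENNReal.top_ne_zero g n
    linarith [norm_le_norm_add_norm_sub' (f n) (g n)]

/-- A linear lift of `F` to bounded sequences is evaluated at one coordinate `n`. Norms converge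
pointwise along `U`; equi-Lipschitz coordinates and compactness of the unit sphere make this uniform
there. -/
theorem finitelyRepresentable_banachUltrapower :
    FinitelyRepresentable 𝕜 (BanachUltrapower 𝕜 X U) X := by
  intro F hF ε hε
  obtain ⟨σ, hσ⟩ := (toUltrapower 𝕜 X U).exists_rightInverse_of_surjective
    (LinearMap.range_eq_top.2 (toUltrapower_surjective 𝕜 X U))
  let L : F →ₗ[𝕜] lp (fun _ : ℕ => X) ∞ := σ ∘ₗ F.subtype
  have hL : ∀ y : F, toUltrapower 𝕜 X U (L y) = y := fun y => LinearMap.congr_fun hσ (y : _)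
  obtain ⟨K, hK0, hK⟩ := (LinearMap.toContinuousLinearMap L).bound
  have hKn : ∀ (y : F) (n : ℕ), ‖L y n‖ ≤ K * ‖y‖ := fun y n =>
    (lp.norm_apply_le_norm ENNReal.top_ne_zero (L y) n).trans (hK y)
  -- The solution of `(1 + δ) / (1 - δ) = 1 + ε`.
  set δ : ℝ := ε / (2 + ε) with hδ
  have hδ0 : 0 < δ := by positivity
  have hδ1 : 0 < 1 - δ := by
    have : 1 - δ = 2 / (2 + ε) := by rw [hδ]; field_simp; ring
    rw [this]; positivity
  have hδε : (1 - δ)⁻¹ * (1 + δ) = 1 + ε := by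
    rw [inv_mul_eq_iff_eq_mul₀ hδ1.ne', hδ]; field_simp; ring
  have : ProperSpace F := FiniteDimensional.proper 𝕜 F
  have hU : ∀ᶠ n in (U : Filter ℕ), ∀ y ∈ Metric.sphere (0 : F) 1,
      1 - δ ≤ ‖L y n‖ ∧ ‖L y n‖ ≤ 1 + δ := by
    refine (isCompact_sphere (0 : F) 1).induction_on (p := fun S => ∀ᶠ n in (U : Filter ℕ),
      ∀ y ∈ S, 1 - δ ≤ ‖L y n‖ ∧ ‖L y n‖ ≤ 1 + δ) (by simp)
      (fun S T hST hT => hT.mono fun n hn y hy => hn y (hST hy))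
      (fun S T hS hT => ?_) fun y hy => ?_
    · filter_upwards [hS, hT] with n h1 h2 y hy
      exact hy.elim (h1 y) (h2 y)
    · refine ⟨Metric.ball y (δ / (2 * K)), mem_nhdsWithin_of_mem_nhds
        (Metric.ball_mem_nhds _ (by positivity)), ?_⟩
      have h1 := tendsto_norm_toUltrapower 𝕜 U (L y)
      rw [hL, show ‖(y : BanachUltrapower 𝕜 X U)‖ = 1 from mem_sphere_zero_iff_norm.1 hy] at h1
      filter_upwards [Metric.tendsto_nhds.1 h1 (δ / 2) (by positivity)] with n hn z hz
      have h2 := hKn (z - y) n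
      rw [map_sub, lp.coeFn_sub, Pi.sub_apply] at h2
      rw [Metric.mem_ball, dist_eq_norm, lt_div_iff₀ (by positivity)] at hz
      rw [Real.dist_eq] at hn
      have h3 := (abs_norm_sub_norm_le (L z n) (L y n)).trans h2
      have h4 := abs_lt.1 hn
      have h5 := abs_le.1 h3
      constructor <;> linarith [h4.1, h4.2, h5.1, h5.2]
  obtain ⟨n, hn⟩ := hU.exists
  let T : F →ₗ[𝕜] X :=
    { toFun := fun y => L y n
      map_add' := fun y z => by simp
      map_smul' := fun c y => by simp }
  have hT : ∀ y, (1 - δ) * ‖y‖ ≤ ‖T y‖ ∧ ‖T y‖ ≤ (1 + δ) * ‖y‖ := by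
    intro y
    rcases eq_or_ne y 0 with rfl | hy
    · simp
    · have hy0 : 0 < ‖y‖ := norm_pos_iff.2 hy
      have h1 := hn (((‖y‖⁻¹ : ℝ) : 𝕜) • y) (by
        rw [mem_sphere_zero_iff_norm, norm_smul, RCLike.norm_ofReal, abs_of_pos (inv_pos.2 hy0),
          inv_mul_cancel₀ hy0.ne'])
      have h2 : ‖T (((‖y‖⁻¹ : ℝ) : 𝕜) • y)‖ = ‖y‖⁻¹ * ‖T y‖ := by
        rw [map_smul, norm_smul, RCLike.norm_ofReal, abs_of_pos (inv_pos.2 hy0)]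
      change 1 - δ ≤ ‖T _‖ ∧ ‖T _‖ ≤ 1 + δ at h1
      rw [h2, le_inv_mul_iff₀ hy0, inv_mul_le_iff₀ hy0] at h1
      constructor <;> linarith [h1.1, h1.2]
  refine ⟨(((1 - δ)⁻¹ : ℝ) : 𝕜) • T, fun y => ?_⟩
  rw [LinearMap.smul_apply, norm_smul, RCLike.norm_ofReal, abs_of_pos (inv_pos.2 hδ1),
    le_inv_mul_iff₀ hδ1, ← hδε, mul_assoc]
  exact ⟨(hT y).1, mul_le_mul_of_nonneg_left (hT y).2 (by positivity)⟩

end Ultrapowers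

/-! ### Copies of `c₀` exclude reflexivity -/

section NonReflexivity

variable {𝕜 : Type v} [RCLike 𝕜] {Y : Type u} [NormedAddCommGroup Y] [NormedSpace 𝕜 Y]

/-- In a reflexive space a bounded sequence has a point that lies in the closure of every convex
set which contains a tail of the sequence. -/
theorem IsReflexiveSpace.exists_mem_closure [NormedSpace ℝ Y] [IsScalarTower ℝ 𝕜 Y]
    (hY : IsReflexiveSpace 𝕜 Y) {s : ℕ → Y} {C : ℝ} (hs : ∀ n, ‖s n‖ ≤ C) :
    ∃ y : Y, ∀ B : Set Y, Convex ℝ B → (∀ᶠ n in atTop, s n ∈ B) → y ∈ closure B := by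
  let U : Ultrafilter ℕ := hyperfilter ℕ
  have hU : (U : Filter ℕ) ≤ atTop := Nat.hyperfilter_le_atTop
  let J : ℕ → WeakDual 𝕜 (StrongDual 𝕜 Y) := fun n =>
    StrongDual.toWeakDual (NormedSpace.inclusionInDoubleDual 𝕜 Y (s n))
  have hJ : ∀ n, J n ∈ WeakDual.toStrongDual ⁻¹'
      Metric.closedBall (0 : StrongDual 𝕜 (StrongDual 𝕜 Y)) C := fun n => by
    have hn : ‖NormedSpace.inclusionInDoubleDual 𝕜 Y (s n)‖ ≤ C :=
      (NormedSpace.double_dual_bound 𝕜 Y (s n)).trans (hs n)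
    exact (mem_closedBall_zero_iff (E := StrongDual 𝕜 (StrongDual 𝕜 Y))).2 hn
  -- Banach–Alaoglu gives a weak-* limit along `U` in the bidual; by reflexivity it comes from a
  -- point `y`, the weak limit of `s` along `U`. Hahn–Banach separation then puts `y` in the
  -- closures.
  obtain ⟨Φ, -, hΦ⟩ := (WeakDual.isCompact_closedBall (𝕜 := 𝕜)
    (0 : StrongDual 𝕜 (StrongDual 𝕜 Y)) C).ultrafilter_le_nhds (U.map J)
      (le_principal_iff.2 (Ultrafilter.mem_map.2 (univ_mem' hJ)))
  obtain ⟨y, hy⟩ := hY (WeakDual.toStrongDual Φ)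
  have hlim : ∀ f : StrongDual 𝕜 Y, Tendsto (fun n => f (s n)) U (𝓝 (f y)) := by
    intro f
    have h1 : Tendsto J U (𝓝 Φ) := hΦ
    have h2 := ((WeakDual.eval_continuous (𝕜 := 𝕜) f).tendsto Φ).comp h1
    have h3 : Φ f = f y := by
      have := congrArg (fun T => T f) hy
      exact this.symm
    rw [← h3]
    exact h2
  refine ⟨y, fun B hB hsB => ?_⟩
  by_contra hyB
  obtain ⟨f, u, hfy, hfB⟩ := RCLike.geometric_hahn_banach_point_closed (𝕜 := 𝕜) hB.closure
    isClosed_closure hyB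
  have h1 : Tendsto (fun n => RCLike.re (f (s n))) U (𝓝 (RCLike.re (f y))) :=
    (RCLike.continuous_re.tendsto _).comp (hlim f)
  have h2 : u ≤ RCLike.re (f y) := by
    refine ge_of_tendsto h1 ?_
    filter_upwards [hU hsB] with n hn
    exact (hfB _ (subset_closure hn)).le
  linarith

/-- A reflexive space contains no sequence spanning a real copy of `c₀`. -/
theorem not_isReflexiveSpace_of_cube_basis [NormedSpace ℝ Y] [IsScalarTower ℝ 𝕜 Y] {e : ℕ → Y}
    (he : ∀ b : ℕ →₀ ℝ, (∀ k, |b k| ≤ 1) → ‖Finsupp.linearCombination ℝ e b‖ ≤ 2 ∧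
      ∀ j, |b j| = 1 → 1 / 2 ≤ ‖Finsupp.linearCombination ℝ e b‖) :
    ¬ IsReflexiveSpace 𝕜 Y := by
  intro hY
  let T := Finsupp.linearCombination ℝ e
  -- The partial sums `e 0 + ⋯ + e (n - 1)` are bounded, but their would-be weak limit is the
  -- constant sequence one, which is not in `c₀`.
  let c : ℕ → ℕ →₀ ℝ := fun n => Finsupp.indicator (Finset.range n) fun _ _ => 1
  have hc : ∀ n k, c n k = if k < n then 1 else 0 := fun n k => by
    simp [c, Finsupp.indicator_apply]
  have hc01 : ∀ n k, c n k ∈ Icc (0 : ℝ) 1 := fun n k => by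
    rw [hc]; split_ifs <;> norm_num
  obtain ⟨y, hy⟩ := hY.exists_mem_closure (s := fun n => T (c n)) (C := 2) fun n =>
    (he _ fun k => abs_le.2 ⟨by linarith [(hc01 n k).1], (hc01 n k).2⟩).1
  have hcube : Convex ℝ {b : ℕ →₀ ℝ | ∀ k, b k ∈ Icc (0 : ℝ) 1} := by
    intro a ha b hb s t hs ht hst k
    exact convex_Icc (0 : ℝ) 1 (ha k) (hb k) hs ht hst
  have hface : ∀ m, Convex ℝ {b : ℕ →₀ ℝ | b m = 1} := by
    intro m a ha b hb s t hs ht hst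
    exact convex_singleton (1 : ℝ) ha hb hs ht hst
  have h1 := hy _ (hcube.linear_image T) (Eventually.of_forall fun n => ⟨c n, hc01 n, rfl⟩)
  obtain ⟨_, ⟨a, ha, rfl⟩, hya⟩ := Metric.mem_closure_iff.1 h1 (1 / 4) (by norm_num)
  obtain ⟨m, hm⟩ := Infinite.exists_notMem_finset a.support
  rw [Finsupp.notMem_support_iff] at hm
  -- The tail beyond `m` lies in the face `b m = 1`, whereas `a m = 0`. Both `T a` and `T b` are
  -- within `1/4` of `y`, yet `a - b` has a coordinate of modulus one, so they are at least `1/2`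
  -- apart.
  have h2 := hy _ ((hcube.inter (hface m)).linear_image T) (by
    filter_upwards [eventually_gt_atTop m] with n hn
    exact ⟨c n, ⟨hc01 n, by simp [hc, hn]⟩, rfl⟩)
  obtain ⟨_, ⟨b, ⟨hb, hbm⟩, rfl⟩, hyb⟩ := Metric.mem_closure_iff.1 h2 (1 / 4) (by norm_num)
  have h3 := (he (a - b) fun k => by
    rw [Finsupp.sub_apply, abs_le]
    constructor <;> linarith [(ha k).1, (ha k).2, (hb k).1, (hb k).2]).2 m (by
      rw [Finsupp.sub_apply, hm, hbm]; norm_num)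
  have h4 : dist (T a) (T b) = ‖Finsupp.linearCombination ℝ e (a - b)‖ := by
    rw [dist_eq_norm, ← map_sub]
  linarith [dist_triangle_left (T a) (T b) y]

end NonReflexivity

/-! ### From cubes in `X` to `c₀` in an ultrapower -/

section SuperReflexivity

open scoped ENNReal

/-- Approximate real copies of `ℓ_∞ⁿ` in `X` yield a real copy of `c₀` in the ultrapower. -/
theorem not_superReflexive_of_exists_cube_basis {𝕜 : Type v} [RCLike 𝕜] {X : Type u}
    [NormedAddCommGroup X] [NormedSpace 𝕜 X] [NormedSpace ℝ X] [IsScalarTower ℝ 𝕜 X]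
    [CompleteSpace X]
    (h : ∀ n : ℕ, ∃ x : ℕ → X, ∀ b : ℕ → ℝ, (∀ k, |b k| ≤ 1) →
      ‖∑ k ∈ Finset.range n, b k • x k‖ ≤ 2 ∧
        ∀ j < n, |b j| = 1 → 1 / 2 ≤ ‖∑ k ∈ Finset.range n, b k • x k‖) :
    ¬ SuperReflexive 𝕜 X := by
  intro hX
  choose x hx using h
  let U : Ultrafilter ℕ := hyperfilter ℕ
  have hU : (U : Filter ℕ) ≤ atTop := Nat.hyperfilter_le_atTop
  have hbound : ∀ k n, ‖if k < n then x n k else 0‖ ≤ 2 := by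
    intro k n
    split_ifs with hk
    · have := (hx n (Pi.single k 1) fun i => by
        rcases eq_or_ne i k with rfl | hi <;> simp [*]).1
      rwa [Finset.sum_eq_single_of_mem k (Finset.mem_range.2 hk) (fun i _ hi => by simp [hi]),
        Pi.single_eq_same, one_smul] at this
    · simp
  let f : ℕ → lp (fun _ : ℕ => X) ∞ := fun k => ⟨fun n => if k < n then x n k else 0,
    memℓp_infty ⟨2, by rintro _ ⟨n, rfl⟩; exact hbound k n⟩⟩
  let e : ℕ → BanachUltrapower 𝕜 X U := fun k => toUltrapower 𝕜 X U (f k)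
  have hlin : ∀ b : ℕ →₀ ℝ, Finsupp.linearCombination ℝ e b =
      toUltrapower 𝕜 X U (Finsupp.linearCombination ℝ f b) := by
    intro b
    rw [Finsupp.linearCombination_apply, Finsupp.linearCombination_apply, Finsupp.sum, Finsupp.sum,
      map_sum]
    rfl
  -- Once `n` exceeds the support of `b`, the coordinate `n` sees the whole combination in the
  -- `n`-th cube.
  have hval : ∀ b : ℕ →₀ ℝ, ∀ᶠ n in (U : Filter ℕ),
      (Finsupp.linearCombination ℝ f b) n = ∑ k ∈ Finset.range n, b k • x n k := by
    intro b
    obtain ⟨m, hm⟩ := b.support.exists_nat_subset_range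
    filter_upwards [hU (eventually_ge_atTop m)] with n hn
    have hsub : b.support ⊆ Finset.range n := hm.trans (Finset.range_mono hn)
    rw [Finsupp.linearCombination_apply, Finsupp.sum, lp.coeFn_sum, Finset.sum_apply]
    rw [← Finset.sum_subset hsub fun k _ hk => by rw [Finsupp.notMem_support_iff.1 hk, zero_smul]]
    refine Finset.sum_congr rfl fun k hk => ?_
    change b k • (if k < n then x n k else 0) = _
    rw [if_pos (Finset.mem_range.1 (hsub hk))]
  refine not_isReflexiveSpace_of_cube_basis (𝕜 := 𝕜) (e := e) (fun b hb => ?_)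
    (hX _ (finitelyRepresentable_banachUltrapower 𝕜 U))
  have ht := tendsto_norm_toUltrapower 𝕜 U (Finsupp.linearCombination ℝ f b)
  rw [← hlin] at ht
  refine ⟨le_of_tendsto ht ?_, fun j hj => ge_of_tendsto ht ?_⟩
  · filter_upwards [hval b] with n hn
    rw [hn]
    exact (hx n b hb).1
  · filter_upwards [hval b, hU (eventually_gt_atTop j)] with n hn hjn
    rw [hn]
    exact (hx n b hb).2 j hjn hj

end SuperReflexivity

theorem corollary5p2 {𝕜 : Type v} [RCLike 𝕜] {X : Type u} [NormedAddCommGroup X]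
    [NormedSpace 𝕜 X] [CompleteSpace X] (hX : SuperReflexive 𝕜 X) :
    (∀ t : ℝ, 0 < t → t ≤ 1 → (averageThresholds X t).Nonempty) ∧
      ∀ p : ℝ, frakP X < p → HasRademacherCotype X p := by
  -- The sign and cube arguments need only real scalars; `𝕜` enters through reflexivity and finite
  -- representability.
  let _ : NormedSpace ℝ X := NormedSpace.restrictScalars ℝ 𝕜 X
  have : IsScalarTower ℝ 𝕜 X := inferInstance
  have hne : ∀ t : ℝ, 0 < t → t ≤ 1 → (averageThresholds X t).Nonempty := by
    by_contra! hcon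
    obtain ⟨t, ht0, -, ht⟩ := hcon
    refine not_superReflexive_of_exists_cube_basis (exists_cube_basis ?_) hX
    intro N hN a ha0 ha1 hbd
    exact (averageThresholds_nonempty hbd hN ha0 ha1 ht0).ne_empty ht
  exact ⟨hne, fun p hp => hasRademacherCotype_of_frakP_lt hne hp⟩
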